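/- Consider a finite set $\Omega\neq\emptyset$ of robots and a finite set $\kappa$ of beacons in $\mathbb{R}^m$, $m=2$, possibly mobile; let $\mathbf{x}_k^{i\ast}$ be the true location of node $i\in\Omega\cup\kappa$ at time $k=0,1,2,\dots$, and let $\alpha,\beta\in(0,1)$. For a set $S$ of nodes let $A_S$ be the $m$-dimensional volume of the convex hull of their true locations at time $k$. A triangulation set of robot $i$ at time $k$ is a set $\Theta$ of $m+1$ nodes other than $i$ with $A_\Theta>0$ such that $\mathbf{x}_k^{i\ast}$ lies in the interior of the convex hull of their locations; the barycentric coordinates of $i$ in $\Theta$ are $a^{ij}_k=A_{\Theta\cup\{i\}\setminus\{j\}}/A_{\Theta}$, $j\in\Theta$. At each time $k$, robot $i$ has an arbitrary set of neighbours; if among them there is a triangulation set in which every beacon $b$ has coordinate $a_k^{ib}\ge\alpha$, one such set is chosen as $\Theta_i(k)$, together with a self-weight $\alpha_k^i\in[\beta,1)$; otherwise $\Theta_i(k)=\emptyset$ and $\alpha_k^i=1$. The location estimates of the robots evolve, without noise, by $$\mathbf{x}_{k+1}^i=\alpha_k^i\,\mathbf{x}_k^i+(1-\alpha_k^i)\Big(\sum_{j\in\Theta_i(k)\cap\Omega}a_k^{ij}\mathbf{x}_k^j+\sum_{b\in\Theta_i(k)\cap\kappa}a_k^{ib}\mathbf{x}_k^{b\ast}\Big)+\big(\mathbf{x}_{k+1}^{i\ast}-\mathbf{x}_k^{i\ast}\big),\qquad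 i\in\Omega,$$ that is, by the LTV dynamics $\mathbf{x}_{k+1}=\mathbf{P}_k\mathbf{x}_k+\mathbf{B}_k\mathbf{u}_k+\widetilde{\mathbf{x}}_{k+1}$. Say that the dynamics track the true robot locations if for every choice of the initial estimates $\mathbf{x}_0^i$ one has $\mathbf{x}_k^{i\ast}-\mathbf{x}_k^i\to0$ as $k\to\infty$ for every $i\in\Omega$. Let $\mathcal{M}_i$ ($i\in\Omega$) and $\mathcal{U}_j$ ($j\in\kappa$) be the linear subspaces spanned by all differences of locations that robot $i$, respectively beacon $j$, occupies over time, and let $\dim\bigcup$ denote the dimension of the linear span of the union of the subspaces. If the LTV dynamics track the true robot locations, then $$|\kappa|\ge1,\qquad |\kappa|+|\Omega|\ge m+2,\qquad |\kappa|+\dim\bigcup_{i\in\Omega}\mathcal{M}_i+\dim\bigcup_{j\in\kappa}\mathcal{U}_j\ge m+1 .$$ This holds for all trajectories of the nodes, in particular for robots moving in a non-trivial configuration (not all remaining on a line). -/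

import Mathlib

/-- `m`-dimensional Euclidean space, in which all nodes are located. -/
abbrev Space (m : ℕ) : Type := EuclideanSpace ℝ (Fin m)

section Geometry

variable {Ω κ : Type*} {m : ℕ}

/-- `A_S`: the `m`-dimensional volume (area for `m = 2`) of the convex hull of the nodes in `S`,
when the nodes are located at `x`. -/
noncomputable def hullVolume (x : Ω ⊕ κ → Space m) (S : Set (Ω ⊕ κ)) : ℝ :=
  (MeasureTheory.volume : MeasureTheory.Measure (Space m)).real (convexHull ℝ (x '' S))

/-- The barycentric coordinate `A_{Θ ∪ {i} \ {j}} / A_Θ` of robot `i` with respect to the node `j`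
of its triangulation set `Θ`. -/
noncomputable def baryCoord (x : Ω ⊕ κ → Space m) (i : Ω) (Θ : Finset (Ω ⊕ κ)) (j : Ω ⊕ κ) : ℝ :=
  hullVolume x (insert (Sum.inl i) (Θ : Set (Ω ⊕ κ)) \ {j}) / hullVolume x (Θ : Set (Ω ⊕ κ))

/-- `Θ` is a triangulation set of robot `i`: it consists of `m + 1` nodes other than `i`, their
convex hull has non-zero volume, and robot `i` lies strictly in the interior of it. -/
structure IsTriangulationSet (x : Ω ⊕ κ → Space m) (i : Ω) (Θ : Finset (Ω ⊕ κ)) : Prop where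
  notMem : Sum.inl i ∉ Θ
  card_eq : Θ.card = m + 1
  volume_pos : 0 < hullVolume x (Θ : Set (Ω ⊕ κ))
  mem_interior : x (Sum.inl i) ∈ interior (convexHull ℝ (x '' (Θ : Set (Ω ⊕ κ))))

/-- A triangulation set with respect to which robot `i` may update: every beacon in it has weight
at least `α`, the minimum beacon contribution. -/
structure IsAdmissible (α : ℝ) (x : Ω ⊕ κ → Space m) (i : Ω) (Θ : Finset (Ω ⊕ κ)) : Prop where
  triangulation : IsTriangulationSet x i Θ
  beacon_weight : ∀ b : κ, Sum.inr b ∈ Θ → α ≤ baryCoord x i Θ (Sum.inr b)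

end Geometry

/-- A (noise-free) run of the localization algorithm in `ℝ^m`, with robots `Ω` and beacons `κ`,
minimum beacon contribution `α` and minimum self-weight `β`: the true trajectories of all nodes,
together with the choices made by the algorithm. The neighbour sets are arbitrary, so that any
communication radius, and any loss of communication, is covered. -/
structure LocalizationRun (Ω κ : Type*) (m : ℕ) (α β : ℝ) where
  /-- The true location of each node at each time. -/
  pos : ℕ → Ω ⊕ κ → Space m
  /-- The neighbours of each robot at each time. -/
  nbr : ℕ → Ω → Finset (Ω ⊕ κ)
  /-- The set `Θ_i(k)` with which robot `i` updates at time `k`; empty if it does not update. -/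
  triSet : ℕ → Ω → Finset (Ω ⊕ κ)
  /-- The weight `α_k` of the robot's own estimate. -/
  selfWeight : ℕ → Ω → ℝ
  /-- A robot which updates does so with an admissible triangulation set of neighbours. -/
  triSet_spec : ∀ k i, (triSet k i).Nonempty →
    triSet k i ⊆ nbr k i ∧ IsAdmissible α (pos k) i (triSet k i)
  /-- A robot fails to update only if there is no such set among its neighbours. -/
  triSet_empty : ∀ k i, triSet k i = ∅ → ∀ S ⊆ nbr k i, ¬ IsAdmissible α (pos k) i S
  selfWeight_of_empty : ∀ k i, triSet k i = ∅ → selfWeight k i = 1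
  selfWeight_of_nonempty : ∀ k i, (triSet k i).Nonempty → selfWeight k i ∈ Set.Ico β 1

namespace LocalizationRun

variable {Ω κ : Type*} {m : ℕ} {α β : ℝ}

/-- The true motion of node `i` between the times `k` and `k + 1`. -/
noncomputable def motion (R : LocalizationRun Ω κ m α β) (k : ℕ) (i : Ω ⊕ κ) : Space m :=
  R.pos (k + 1) i - R.pos k i

open Classical in
/-- The barycentric weight `a_k^{ij}`, which is zero for the nodes outside `Θ_i(k)`. -/
noncomputable def weight (R : LocalizationRun Ω κ m α β) (k : ℕ) (i : Ω) (j : Ω ⊕ κ) : ℝ :=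
  if j ∈ R.triSet k i then baryCoord (R.pos k) i (R.triSet k i) j else 0

open Classical in
/-- The system matrix `P_k`. -/
noncomputable def systemMatrix (R : LocalizationRun Ω κ m α β) (k : ℕ) : Matrix Ω Ω ℝ :=
  fun i j => (if i = j then R.selfWeight k i else 0) +
    (1 - R.selfWeight k i) * R.weight k i (Sum.inl j)

/-- The input matrix `B_k`. -/
noncomputable def inputMatrix (R : LocalizationRun Ω κ m α β) (k : ℕ) : Matrix Ω κ ℝ :=
  fun i b => (1 - R.selfWeight k i) * R.weight k i (Sum.inr b)

/-- The location estimates: the solution of the LTV dynamics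
`x_{k+1} = P_k x_k + B_k u_k + x̃_{k+1}` with initial estimates `x₀`, where `u_k` are the true
beacon locations and `x̃_{k+1}` are the true motions of the robots. -/
noncomputable def estimate [Fintype Ω] [Fintype κ] (R : LocalizationRun Ω κ m α β)
    (x₀ : Ω → Space m) : ℕ → Ω → Space m
  | 0 => x₀
  | k + 1 => fun i =>
      ∑ j, R.systemMatrix k i j • R.estimate x₀ k j
        + ∑ b, R.inputMatrix k i b • R.pos k (Sum.inr b)
        + R.motion k (Sum.inl i)

/-- The LTV dynamics track the true robot locations: for every initialization, the error of the
location estimate of every robot tends to zero. -/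
def Tracks [Fintype Ω] [Fintype κ] (R : LocalizationRun Ω κ m α β) : Prop :=
  ∀ (x₀ : Ω → Space m) (i : Ω),
    Filter.Tendsto (fun k => R.pos k (Sum.inl i) - R.estimate x₀ k i) Filter.atTop (nhds 0)

/-- The subspace of the directions in which node `i` moves: the direction of the smallest affine
subspace that contains all its locations. -/
noncomputable def motionSubspace (R : LocalizationRun Ω κ m α β) (i : Ω ⊕ κ) : Submodule ℝ (Space m) :=
  vectorSpan ℝ (Set.range fun k => R.pos k i)

/-- `dim ⋃_{i ∈ Ω} M_i`: the dimension of the span of the motion subspaces of the robots. -/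
noncomputable def robotMotionDim (R : LocalizationRun Ω κ m α β) : ℕ :=
  Module.finrank ℝ (⨆ i : Ω, R.motionSubspace (Sum.inl i) : Submodule ℝ (Space m))

/-- `dim ⋃_{j ∈ κ} U_j`: the dimension of the span of the motion subspaces of the beacons. -/
noncomputable def beaconMotionDim (R : LocalizationRun Ω κ m α β) : ℕ :=
  Module.finrank ℝ (⨆ j : κ, R.motionSubspace (Sum.inr j) : Submodule ℝ (Space m))

end LocalizationRun

/-!
Each of the three inequalities is proved by exhibiting estimates whose errors do not tend to zero.

*A robot that never updates keeps its initial error.* This gives the last two inequalities. A robot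
can update only if there are `m + 1` other nodes, hence `|κ| + |Ω| ≥ m + 2`. If the third
inequality fails for `|κ| ≥ 1`, then the directions of motion of all nodes, together with the
differences of the initial beacon locations, span a proper subspace. A nonzero linear functional
`f` that vanishes on it is constant in time along every trajectory, and takes one common value `c`
on the beacons. A robot at which `f` is maximal (if this maximum is at least `c`) or minimal
(otherwise) has `f`-value extremal among all nodes at all times, so it is never in the interior
of a convex hull of nodes (`LocalizationRun.exists_triSet_eq_empty`).

*Without beacons, a common error of all robots does not decay.* The difference of two sequences of
estimates evolves by the nonnegative matrices `P_k` alone, and the row sums of `P_k` are at least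
`1`: if a point `q` of the convex hull of a finite set `T` replaces the points of `T` one at a time,
the resulting hulls cover the hull of `T` (`exists_mem_convexHull_insert_diff`), so the barycentric
coordinates, defined as ratios of volumes, sum to at least `1` by subadditivity. Equality holds,
but is not needed.
-/

/-! ### Convex hulls of finite sets -/

/-- The convex hulls of the sets obtained from `T` by exchanging one point for a given point `q` of
the convex hull of `T` cover the convex hull of `T`. -/
theorem exists_mem_convexHull_insert_diff {E : Type*} [AddCommGroup E] [Module ℝ E] (T : Finset E)
    {p q : E} (hp : p ∈ convexHull ℝ (T : Set E)) (hq : q ∈ convexHull ℝ (T : Set E)) :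
    ∃ y ∈ T, p ∈ convexHull ℝ (insert q ((T : Set E) \ {y})) := by
  classical
  obtain ⟨w, hw0, hw1, rfl⟩ := Finset.mem_convexHull'.1 hp
  obtain ⟨u, hu0, hu1, hq⟩ := Finset.mem_convexHull'.1 hq
  have hne : (T.filter fun y => 0 < u y).Nonempty := by
    by_contra h
    rw [Finset.not_nonempty_iff_eq_empty, Finset.filter_eq_empty_iff] at h
    have : ∑ y ∈ T, u y ≤ 0 := Finset.sum_nonpos fun y hy => not_lt.1 (h hy)
    linarith
  -- The largest multiple of the weights `u` that can be subtracted from `w` makes one weight zero.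
  obtain ⟨z, hz, hmin⟩ := Finset.exists_min_image _ (fun y => w y / u y) hne
  obtain ⟨hzT, huz⟩ := Finset.mem_filter.1 hz
  set t := w z / u z with ht
  have ht0 : 0 ≤ t := div_nonneg (hw0 z hzT) huz.le
  have hc0 : ∀ y ∈ T, 0 ≤ w y - t * u y := by
    intro y hy
    rcases (hu0 y hy).eq_or_lt with h | h
    · rw [← h]
      simpa using hw0 y hy
    · have := (le_div_iff₀ h).1 (hmin y (Finset.mem_filter.2 ⟨hy, h⟩))
      linarith
  have hcz : w z - t * u z = 0 := by
    rw [ht]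
    field_simp
    ring
  refine ⟨z, hzT, ?_⟩
  have key := (convex_convexHull ℝ (insert q ((T : Set E) \ {z}))).sum_mem (t := T)
    (w := fun y => (w y - t * u y) + if y = z then t else 0) (z := fun y => if y = z then q else y)
    ?_ ?_ ?_
  · convert key using 1
    have h1 : ∀ y ∈ T, ((w y - t * u y) + if y = z then t else 0) • (if y = z then q else y)
        = (w y • y - t • u y • y) + if y = z then t • q else 0 := by
      intro y _
      by_cases h : y = z
      · subst h
        have : w y • y - t • u y • y = 0 := by
          rw [smul_smul, ← sub_smul, hcz, zero_smul]
        simp [hcz, this]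
      · simp [h, sub_smul, smul_smul]
    rw [Finset.sum_congr rfl h1, Finset.sum_add_distrib, Finset.sum_sub_distrib, ← Finset.smul_sum,
      hq, Finset.sum_ite_eq' T z, if_pos hzT, sub_add_cancel]
  · intro y hy
    have := hc0 y hy
    split_ifs <;> linarith
  · rw [Finset.sum_add_distrib, Finset.sum_sub_distrib, ← Finset.mul_sum, hw1, hu1,
      Finset.sum_ite_eq' T z, if_pos hzT]
    ring
  · intro y hy
    apply subset_convexHull
    by_cases h : y = z
    · simp [h]
    · simp [h, hy]

/-- A nonzero linear functional is smaller at an interior point of a convex hull than its bound on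
the generating set. -/
theorem lt_of_mem_interior_convexHull {E : Type*} [NormedAddCommGroup E] [NormedSpace ℝ E]
    {f : StrongDual ℝ E} (hf : f ≠ 0) {s : Set E} {c : ℝ} (hs : ∀ y ∈ s, f y ≤ c) {x : E}
    (hx : x ∈ interior (convexHull ℝ s)) : f x < c := by
  have h : f '' interior (convexHull ℝ s) ⊆ interior (Set.Iic c) := by
    refine interior_maximal ?_ (f.isOpenMap_of_ne_zero hf _ isOpen_interior)
    rintro _ ⟨y, hy, rfl⟩
    have hc : Convex ℝ {y | f y ≤ c} := convex_halfSpace_le f.toLinearMap.isLinear c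
    exact convexHull_min hs hc (interior_subset hy)
  simpa using h ⟨x, hx, rfl⟩

/-! ### Barycentric coordinates as ratios of volumes -/

section Geometry

variable {Ω κ : Type*} {m : ℕ}

theorem hullVolume_nonneg (x : Ω ⊕ κ → Space m) (S : Set (Ω ⊕ κ)) : 0 ≤ hullVolume x S :=
  MeasureTheory.measureReal_nonneg

theorem baryCoord_nonneg (x : Ω ⊕ κ → Space m) (i : Ω) (Θ : Finset (Ω ⊕ κ)) (j : Ω ⊕ κ) :
    0 ≤ baryCoord x i Θ j :=
  div_nonneg (hullVolume_nonneg _ _) (hullVolume_nonneg _ _)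

theorem one_le_sum_baryCoord {x : Ω ⊕ κ → Space m} {i : Ω} {Θ : Finset (Ω ⊕ κ)}
    (h : IsTriangulationSet x i Θ) : 1 ≤ ∑ j ∈ Θ, baryCoord x i Θ j := by
  classical
  have hfin : ∀ S : Set (Ω ⊕ κ), S.Finite →
      MeasureTheory.volume (convexHull ℝ (x '' S)) ≠ ⊤ := fun S hS =>
    ((hS.image x).isCompact_convexHull ℝ).measure_lt_top.ne
  have hcov : convexHull ℝ (x '' (Θ : Set (Ω ⊕ κ))) ⊆
      ⋃ j ∈ Θ, convexHull ℝ (x '' (insert (Sum.inl i) (Θ : Set (Ω ⊕ κ)) \ {j})) := by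
    intro p hp
    have hq := interior_subset h.mem_interior
    rw [← Finset.coe_image] at hp hq
    obtain ⟨y, hy, hpy⟩ := exists_mem_convexHull_insert_diff _ hp hq
    obtain ⟨j, hj, rfl⟩ := Finset.mem_image.1 hy
    refine Set.mem_iUnion₂.2 ⟨j, hj, convexHull_mono ?_ hpy⟩
    rintro z (rfl | ⟨hz, hzj⟩)
    · refine ⟨Sum.inl i, ⟨Set.mem_insert _ _, ?_⟩, rfl⟩
      rintro rfl
      exact h.notMem hj
    · obtain ⟨l, hl, rfl⟩ := Finset.mem_image.1 hz
      refine ⟨l, ⟨Set.mem_insert_of_mem _ hl, ?_⟩, rfl⟩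
      rintro rfl
      exact hzj rfl
  have hvol : hullVolume x (Θ : Set (Ω ⊕ κ)) ≤
      ∑ j ∈ Θ, hullVolume x (insert (Sum.inl i) (Θ : Set (Ω ⊕ κ)) \ {j}) := by
    refine (MeasureTheory.measureReal_mono hcov ?_).trans
      (MeasureTheory.measureReal_biUnion_finset_le _ _)
    exact (MeasureTheory.measure_biUnion_lt_top Θ.finite_toSet fun j _ =>
      (hfin _ ((Θ.finite_toSet.insert _).sdiff)).lt_top).ne
  simp only [baryCoord]
  rwa [← Finset.sum_div, one_le_div h.volume_pos]

end Geometry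

namespace LocalizationRun

variable {Ω κ : Type*} {m : ℕ} {α β : ℝ}

/-! ### Robots that never update -/

theorem weight_nonneg (R : LocalizationRun Ω κ m α β) (k : ℕ) (i : Ω) (j : Ω ⊕ κ) :
    0 ≤ R.weight k i j := by
  unfold weight
  split_ifs
  · exact baryCoord_nonneg _ _ _ _
  · exact le_rfl

theorem estimate_succ_of_triSet_eq_empty [Fintype Ω] [Fintype κ] (R : LocalizationRun Ω κ m α β)
    (x₀ : Ω → Space m) {k : ℕ} {i : Ω} (h : R.triSet k i = ∅) :
    R.estimate x₀ (k + 1) i = R.estimate x₀ k i + R.motion k (Sum.inl i) := by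
  classical
  have hs := R.selfWeight_of_empty k i h
  simp [estimate, systemMatrix, inputMatrix, hs, ite_smul]

/-- If the estimates track the true locations, then every robot updates at some time. -/
theorem Tracks.exists_triSet_nonempty [Fintype Ω] [Fintype κ] {R : LocalizationRun Ω κ m α β}
    [Nonempty (Fin m)] (hR : R.Tracks) (i : Ω) : ∃ k, (R.triSet k i).Nonempty := by
  by_contra! h
  obtain ⟨v, hv⟩ := exists_ne (0 : Space m)
  have herr : ∀ k, R.pos k (Sum.inl i) -
      R.estimate (fun i => R.pos 0 (Sum.inl i) - v) k i = v := by
    intro k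
    induction k with
    | zero => simp [estimate]
    | succ k ih =>
      rw [estimate_succ_of_triSet_eq_empty R _ (h k), motion, add_comm (R.estimate _ _ _),
        sub_add_eq_sub_sub, sub_sub_cancel, ih]
  have := hR (fun i => R.pos 0 (Sum.inl i) - v) i
  simp only [herr] at this
  exact hv (tendsto_nhds_unique tendsto_const_nhds this)

theorem isTriangulationSet_triSet (R : LocalizationRun Ω κ m α β) {k : ℕ} {i : Ω}
    (h : (R.triSet k i).Nonempty) : IsTriangulationSet (R.pos k) i (R.triSet k i) :=
  (R.triSet_spec k i h).2.triangulation

/-- If a nonzero linear functional is constant along the trajectories and has the same value on all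
beacons, then some robot never updates. -/
theorem exists_triSet_eq_empty [Finite Ω] [Nonempty Ω] (R : LocalizationRun Ω κ m α β)
    {f : StrongDual ℝ (Space m)} (hf : f ≠ 0) {c : ℝ} {r : Ω → ℝ}
    (hΩ : ∀ k i, f (R.pos k (Sum.inl i)) = r i) (hκ : ∀ k b, f (R.pos k (Sum.inr b)) = c) :
    ∃ i, ∀ k, R.triSet k i = ∅ := by
  obtain ⟨i, hi⟩ := Finite.exists_max r
  by_cases hc : c ≤ r i
  · refine ⟨i, fun k => Finset.not_nonempty_iff_eq_empty.1 fun hne => ?_⟩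
    refine (lt_of_mem_interior_convexHull hf ?_
      (R.isTriangulationSet_triSet hne).mem_interior).ne (hΩ k i)
    rintro _ ⟨j | b, -, rfl⟩
    · exact (hΩ k j).trans_le (hi j)
    · exact (hκ k b).trans_le hc
  -- All robots lie strictly below the beacons, so that the lowest robot is the lowest node.
  · obtain ⟨l, hl⟩ := Finite.exists_min r
    refine ⟨l, fun k => Finset.not_nonempty_iff_eq_empty.1 fun hne => ?_⟩
    refine (lt_of_mem_interior_convexHull (f := -f) (c := -r l) (neg_ne_zero.2 hf) ?_
      (R.isTriangulationSet_triSet hne).mem_interior).ne ?_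
    · rintro _ ⟨j | b, -, rfl⟩
      · have := hΩ k j
        have := hl j
        simp only [_root_.neg_apply]
        linarith
      · have := hκ k b
        have := hi l
        simp only [_root_.neg_apply]
        linarith
    · simp [hΩ k l]

/-- If there are beacons, but few beacons and few directions of motion, then there is a nonzero
linear functional as in `exists_triSet_eq_empty`. -/
theorem exists_functional [Fintype κ] [Nonempty κ] (R : LocalizationRun Ω κ m α β)
    (h : Fintype.card κ + R.robotMotionDim + R.beaconMotionDim ≤ m) :
    ∃ f : StrongDual ℝ (Space m), f ≠ 0 ∧ (∀ k i, f (R.pos k i) = f (R.pos 0 i)) ∧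
      ∀ b b' : κ, f (R.pos 0 (Sum.inr b)) = f (R.pos 0 (Sum.inr b')) := by
  set M : Submodule ℝ (Space m) := ⨆ i : Ω, R.motionSubspace (Sum.inl i) with hM
  set U : Submodule ℝ (Space m) := ⨆ j : κ, R.motionSubspace (Sum.inr j) with hU
  set D : Submodule ℝ (Space m) := vectorSpan ℝ (Set.range fun b : κ => R.pos 0 (Sum.inr b)) with hD
  have hDdim : Module.finrank ℝ D + 1 ≤ Fintype.card κ :=
    finrank_vectorSpan_range_add_one_le ℝ _
  have hlt : M ⊔ U ⊔ D < ⊤ := by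
    refine lt_top_iff_ne_top.2 fun htop => ?_
    have h1 := Submodule.finrank_add_le_finrank_add_finrank (M ⊔ U) D
    have h2 := Submodule.finrank_add_le_finrank_add_finrank M U
    rw [htop, finrank_top, finrank_euclideanSpace_fin] at h1
    have h3 : R.robotMotionDim = Module.finrank ℝ M := rfl
    have h4 : R.beaconMotionDim = Module.finrank ℝ U := rfl
    omega
  obtain ⟨g, hg, hker⟩ := Submodule.exists_le_ker_of_lt_top _ hlt
  have hdiff : ∀ x y : Space m, x - y ∈ M ⊔ U ⊔ D → g x = g y := fun x y hxy => by
    have := LinearMap.mem_ker.1 (hker hxy)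
    rwa [map_sub, sub_eq_zero] at this
  have hmotion : ∀ k i, R.pos k i - R.pos 0 i ∈ R.motionSubspace i := fun k i =>
    vsub_mem_vectorSpan ℝ (Set.mem_range_self k) (Set.mem_range_self 0)
  refine ⟨LinearMap.toContinuousLinearMap g, ?_, ?_, ?_⟩
  · simpa using hg
  · rintro k (i | b)
    · exact hdiff _ _ (Submodule.mem_sup_left (Submodule.mem_sup_left
        (Submodule.mem_iSup_of_mem i (hmotion k _))))
    · exact hdiff _ _ (Submodule.mem_sup_left (Submodule.mem_sup_right
        (Submodule.mem_iSup_of_mem b (hmotion k _))))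
  · intro b b'
    exact hdiff _ _ (Submodule.mem_sup_right
      (vsub_mem_vectorSpan ℝ (Set.mem_range_self b) (Set.mem_range_self b')))

/-! ### Runs without beacons -/

theorem selfWeight_mem_Icc (R : LocalizationRun Ω κ m α β) (hβ : 0 ≤ β) (k : ℕ) (i : Ω) :
    R.selfWeight k i ∈ Set.Icc 0 1 := by
  rcases (R.triSet k i).eq_empty_or_nonempty with h | h
  · rw [R.selfWeight_of_empty k i h]
    simp
  · have := R.selfWeight_of_nonempty k i h
    exact ⟨hβ.trans this.1, this.2.le⟩

theorem systemMatrix_nonneg (R : LocalizationRun Ω κ m α β) (hβ : 0 ≤ β) (k : ℕ) (i j : Ω) :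
    0 ≤ R.systemMatrix k i j := by
  have h := R.selfWeight_mem_Icc hβ k i
  have := mul_nonneg (sub_nonneg.2 h.2) (R.weight_nonneg k i (Sum.inl j))
  unfold systemMatrix
  split_ifs <;> linarith [h.1]

theorem one_le_sum_systemMatrix [Fintype Ω] [IsEmpty κ] (R : LocalizationRun Ω κ m α β) (hβ : 0 ≤ β)
    (k : ℕ) (i : Ω) : 1 ≤ ∑ j, R.systemMatrix k i j := by
  classical
  have hsum : ∑ j, R.systemMatrix k i j =
      R.selfWeight k i + (1 - R.selfWeight k i) * ∑ j, R.weight k i (Sum.inl j) := by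
    simp only [systemMatrix, Finset.sum_add_distrib, Finset.mul_sum, Finset.sum_ite_eq,
      Finset.mem_univ, if_true]
  rw [hsum]
  rcases (R.triSet k i).eq_empty_or_nonempty with h | h
  · simp [R.selfWeight_of_empty k i h]
  · have hw : 1 ≤ ∑ j, R.weight k i (Sum.inl j) := by
      have h1 := one_le_sum_baryCoord (R.isTriangulationSet_triSet h)
      let : Fintype κ := Fintype.ofIsEmpty
      have h2 : ∑ j : Ω ⊕ κ, R.weight k i j = ∑ j ∈ R.triSet k i,
          baryCoord (R.pos k) i (R.triSet k i) j := by
        simp only [weight, Finset.sum_ite_mem, Finset.univ_inter]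
      rw [Fintype.sum_sum_type] at h2
      simpa using h1.trans_eq h2.symm
    nlinarith [(R.selfWeight_mem_Icc hβ k i).2]

/-- Without beacons, an initial shift `v` common to all robots shifts the estimate of each robot at
each time by a multiple `c • v` with `c ≥ 1`. -/
theorem exists_estimate_add_eq [Fintype Ω] [Fintype κ] [IsEmpty κ] (R : LocalizationRun Ω κ m α β)
    (hβ : 0 ≤ β) (x₀ : Ω → Space m) (v : Space m) (k : ℕ) :
    ∃ c : Ω → ℝ, (∀ i, 1 ≤ c i) ∧
      ∀ i, R.estimate (fun i => x₀ i + v) k i = R.estimate x₀ k i + c i • v := by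
  induction k with
  | zero => exact ⟨fun _ => 1, fun _ => le_rfl, fun i => by simp [estimate]⟩
  | succ k ih =>
    obtain ⟨c, hc, h⟩ := ih
    refine ⟨fun i => ∑ j, R.systemMatrix k i j * c j, fun i => ?_, fun i => ?_⟩
    · refine (R.one_le_sum_systemMatrix hβ k i).trans (Finset.sum_le_sum fun j _ => ?_)
      exact le_mul_of_one_le_right (R.systemMatrix_nonneg hβ k i j) (hc j)
    · simp only [estimate, h, smul_add, Finset.sum_add_distrib, Finset.sum_smul, smul_smul]
      abel

theorem Tracks.nonempty_beacons [Fintype Ω] [Fintype κ] [Nonempty Ω] [Nonempty (Fin m)]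
    {R : LocalizationRun Ω κ m α β} (hβ : 0 ≤ β) (hR : R.Tracks) : Nonempty κ := by
  by_contra hκ
  rw [not_nonempty_iff] at hκ
  obtain ⟨i⟩ := ‹Nonempty Ω›
  obtain ⟨v, hv⟩ := exists_ne (0 : Space m)
  have hlim := ((hR 0 i).sub (hR (fun i => (0 : Ω → Space m) i + v) i)).norm
  rw [sub_zero, norm_zero] at hlim
  refine (norm_pos_iff.2 hv).not_ge (ge_of_tendsto' hlim fun k => ?_)
  obtain ⟨c, hc, h⟩ := R.exists_estimate_add_eq hβ 0 v k
  rw [h i, sub_sub_sub_cancel_left, add_sub_cancel_left, norm_smul]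
  exact le_mul_of_one_le_left (norm_nonneg v) ((hc i).trans (le_abs_self _))

end LocalizationRun

theorem theorem3 {Ω κ : Type*} [Fintype Ω] [Fintype κ] [Nonempty Ω]
    {α β : ℝ} (hα : α ∈ Set.Ioo (0 : ℝ) 1) (hβ : β ∈ Set.Ioo (0 : ℝ) 1)
    (R : LocalizationRun Ω κ 2 α β) (hR : R.Tracks) :
    1 ≤ Fintype.card κ ∧
      2 + 2 ≤ Fintype.card κ + Fintype.card Ω ∧
      2 + 1 ≤ Fintype.card κ + R.robotMotionDim + R.beaconMotionDim := by
  have hκ : Nonempty κ := hR.nonempty_beacons hβ.1.le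
  refine ⟨Fintype.card_pos, ?_, ?_⟩
  · obtain ⟨i⟩ := ‹Nonempty Ω›
    obtain ⟨k, hk⟩ := hR.exists_triSet_nonempty i
    have ht := R.isTriangulationSet_triSet hk
    have hlt : (R.triSet k i).card < Fintype.card (Ω ⊕ κ) :=
      Finset.card_lt_univ_of_notMem ht.notMem
    rw [ht.card_eq, Fintype.card_sum] at hlt
    omega
  · by_contra hlt
    obtain ⟨f, hf, hmove, hbeacon⟩ := R.exists_functional (by omega)
    obtain ⟨b⟩ := hκ
    obtain ⟨i, hi⟩ := R.exists_triSet_eq_empty hf (r := fun i => f (R.pos 0 (Sum.inl i)))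
      (c := f (R.pos 0 (Sum.inr b))) (fun k i => hmove k _)
      (fun k b' => (hmove k _).trans (hbeacon b' b))
    obtain ⟨k, hk⟩ := hR.exists_triSet_nonempty i
    exact hk.ne_empty (hi k)
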